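/- Let $A$ be a set of actions. Star expressions over $A$ are generated by $e ::= 0 \mid a \mid (e_1+e_2) \mid (e_1\cdot e_2)\mid (e_1^{\circledast}e_2)$ with $a\in A$ (there is no constant $1$, and $\circledast$ is the binary Kleene star). Transitions $e\xrightarrow{a}\xi$, where $\xi$ is a star expression or the termination symbol $\surd$, are defined inductively by the rules - $a\xrightarrow{a}\surd$; - if $e_i\xrightarrow{a}\xi$ for $i=1$ or $i=2$, then $e_1+e_2\xrightarrow{a}\xi$; - if $e_1\xrightarrow{a}e_1'$, then $e_1\cdot e_2\xrightarrow{a}e_1'\cdot e_2$; if $e_1\xrightarrow{a}\surd$, then $e_1\cdot e_2\xrightarrow{a}e_2$; - if $e_1\xrightarrow{a}e_1'$, then $e_1^{\circledast}e_2\xrightarrow{a}e_1'\cdot(e_1^{\circledast}e_2)$; if $e_1\xrightarrow{a}\surd$, then $e_1^{\circledast}e_2\xrightarrow{a}e_1^{\circledast}e_2$; if $e_2\xrightarrow{a}\xi$, then $e_1^{\circledast}e_2\xrightarrow{a}\xi$ (here $e_1'$ is a star expression). The chart interpretation $\mathcal{C}(e)$ of $e$ is the finite chart with start vertex $e$ whose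 vertices are all elements of the set of star expressions together with $\surd$ that are reachable from $e$ by finitely many (possibly zero) transitions, with the transitions between them; $\surd$ has no outgoing transitions. A bisimulation between $\mathcal{C}(e_1)$ and $\mathcal{C}(e_2)$ is a relation $B$ between their vertex sets such that $e_1\mathrel{B}e_2$ and, whenever $v_1\mathrel{B}v_2$: every transition $v_1\xrightarrow{a}v_1'$ is matched by some $v_2\xrightarrow{a}v_2'$ with $v_1'\mathrel{B}v_2'$; every transition $v_2\xrightarrow{a}v_2'$ is matched by some $v_1\xrightarrow{a}v_1'$ with $v_1'\mathrel{B}v_2'$; and $v_1=\surd$ if and only if $v_2=\surd$. Two charts are bisimilar if there is a bisimulation between them. The proof system $\mathsf{BBP}$ for equations between star expressions consists of the rules of equational logic (reflexivity, symmetry, transitivity, congruence, substitution), the axioms (B1) $x+y=y+x$; (B2) $(x+y)+z=x+(y+z)$; (B3) $x+x=x$; (B4) $(x+y)\cdot z=x\cdot z+y\cdot z$; (B5) $(x\cdot y)\cdot z=x\cdot(y\cdot z)$; (B6) $x+0=x$; (B7) $0\cdot x=0$; (BKS1) $x\cdot(x^{\circledast}y)+y=x^{\circledast}y$; (BKS2)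 $(x^{\circledast}y)\cdot z=x^{\circledast}(y\cdot z)$; and the rule ($\mathrm{RSP}^{\circledast}$): from $x=(y\cdot x)+z$ infer $x=y^{\circledast}z$. **Theorem (completeness of $\mathsf{BBP}$).** For all star expressions $e_1,e_2$ over $A$: if the chart interpretations $\mathcal{C}(e_1)$ and $\mathcal{C}(e_2)$ are bisimilar, then the equation $e_1=e_2$ is derivable in $\mathsf{BBP}$. -/

import Mathlib

universe u v w

/-- Star expressions over a set `A` of actions, without `1` and with binary Kleene star:
`e ::= 0 | a | (e₁ + e₂) | (e₁ · e₂) | (e₁ ⊛ e₂)`. -/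
inductive StarExp (A : Type u) : Type u
  | zero : StarExp A
  | act : A → StarExp A
  | sum : StarExp A → StarExp A → StarExp A
  | prod : StarExp A → StarExp A → StarExp A
  | star : StarExp A → StarExp A → StarExp A

/-- Finite sink-termination charts with actions from `A`, whose non-terminating vertices are
taken from `X`. A vertex is an element of `Option X`, where `none` is the special vertex `√`
(which may or may not belong to the chart) and `some x` is an ordinary vertex. -/
structure Chart (A : Type u) (X : Type v) where
  /-- The set of vertices. -/
  verts : Set (Option X)
  finite_verts : verts.Finite
  /-- The start vertex, which is different from `√`. -/
  start : X
  start_mem : some start ∈ verts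
  /-- The transitions: `trans p a q` is the transition `p —a→ q`. -/
  trans : Option X → A → Option X → Prop
  source_mem : ∀ p a q, trans p a q → p ∈ verts
  target_mem : ∀ p a q, trans p a q → q ∈ verts
  /-- `√` has no outgoing transitions. -/
  tick_sink : ∀ a q, ¬ trans none a q
  /-- Every vertex is reachable by a path from the start vertex. -/
  connected : ∀ p ∈ verts,
    Relation.ReflTransGen (fun p q => ∃ a, trans p a q) (some start) p

namespace Chart

variable {A : Type u} {X : Type v} {Y : Type w}

/-- `B` is a bisimulation between the charts `C` and `D`. -/
structure IsBisimulation (C : Chart A X) (D : Chart A Y)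
    (B : Option X → Option Y → Prop) : Prop where
  mem_verts : ∀ p q, B p q → p ∈ C.verts ∧ q ∈ D.verts
  start : B (some C.start) (some D.start)
  forth : ∀ p q, B p q → ∀ a p', C.trans p a p' → ∃ q', D.trans q a q' ∧ B p' q'
  back : ∀ p q, B p q → ∀ a q', D.trans q a q' → ∃ p', C.trans p a p' ∧ B p' q'
  termination : ∀ p q, B p q → (p = none ↔ q = none)

/-- The charts `C` and `D` are bisimilar. -/
def Bisimilar (C : Chart A X) (D : Chart A Y) : Prop :=
  ∃ B : Option X → Option Y → Prop, IsBisimulation C D B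

end Chart

namespace StarExp

variable {A : Type u}

/-- The transition system specification: `Step e a ξ` says that `e —a→ ξ` can be proved, that is,
`ξ` is an `a`-derivative of `e`. Here `ξ` is a star expression `some e'` or `√ = none`. -/
inductive Step : StarExp A → A → Option (StarExp A) → Prop
  | act (a : A) : Step (act a) a none
  | sum_left {e₁ e₂ : StarExp A} {a : A} {ξ : Option (StarExp A)} :
      Step e₁ a ξ → Step (sum e₁ e₂) a ξ
  | sum_right {e₁ e₂ : StarExp A} {a : A} {ξ : Option (StarExp A)} :
      Step e₂ a ξ → Step (sum e₁ e₂) a ξ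
  | prod_exp {e₁ e₂ e₁' : StarExp A} {a : A} :
      Step e₁ a (some e₁') → Step (prod e₁ e₂) a (some (prod e₁' e₂))
  | prod_tick {e₁ e₂ : StarExp A} {a : A} :
      Step e₁ a none → Step (prod e₁ e₂) a (some e₂)
  | star_exp {e₁ e₂ e₁' : StarExp A} {a : A} :
      Step e₁ a (some e₁') → Step (star e₁ e₂) a (some (prod e₁' (star e₁ e₂)))
  | star_tick {e₁ e₂ : StarExp A} {a : A} :
      Step e₁ a none → Step (star e₁ e₂) a (some (star e₁ e₂))
  | star_exit {e₁ e₂ : StarExp A} {a : A} {ξ : Option (StarExp A)} :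
      Step e₂ a ξ → Step (star e₁ e₂) a ξ

/-- The transition relation on star expressions together with `√`, which is a sink. -/
def Trans (p : Option (StarExp A)) (a : A) (q : Option (StarExp A)) : Prop :=
  ∃ e, p = some e ∧ Step e a q

/-- The iterated derivatives of `e`: everything reachable from `e` (including `e` itself) by a
finite path of transitions. -/
def iteratedDerivatives (e : StarExp A) : Set (Option (StarExp A)) :=
  {p | Relation.ReflTransGen (fun p q => ∃ a, Trans p a q) (some e) p}

/-- An auxiliary finite set that contains all derivatives of `e` and is closed under derivatives.
It is used only to show that there are finitely many iterated derivatives. -/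
def derivBound : StarExp A → Set (Option (StarExp A))
  | zero => ∅
  | act _ => {none}
  | sum e f => derivBound e ∪ derivBound f
  | prod e f => Option.map (fun x => prod x f) '' derivBound e ∪ {some f} ∪ derivBound f
  | star e f =>
      Option.map (fun x => prod x (star e f)) '' derivBound e ∪ {some (star e f)} ∪ derivBound f

theorem derivBound_finite (e : StarExp A) : (derivBound e).Finite := by
  induction e with
  | zero => exact Set.finite_empty
  | act a => exact Set.finite_singleton _
  | sum e f he hf => exact he.union hf
  | prod e f he hf => exact ((he.image _).union (Set.finite_singleton _)).union hf
  | star e f he hf => exact ((he.image _).union (Set.finite_singleton _)).union hf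

theorem step_mem_derivBound {e : StarExp A} {a : A} {ξ : Option (StarExp A)} (h : Step e a ξ) :
    ξ ∈ derivBound e := by
  induction h with
  | act a => exact rfl
  | sum_left _ ih => exact Or.inl ih
  | sum_right _ ih => exact Or.inr ih
  | prod_exp _ ih => exact Or.inl (Or.inl ⟨_, ih, rfl⟩)
  | prod_tick _ _ => exact Or.inl (Or.inr rfl)
  | star_exp _ ih => exact Or.inl (Or.inl ⟨_, ih, rfl⟩)
  | star_tick _ _ => exact Or.inl (Or.inr rfl)
  | star_exit _ ih => exact Or.inr ih

theorem derivBound_closed (e : StarExp A) :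
    ∀ (x : StarExp A) (a : A) (ξ : Option (StarExp A)),
      some x ∈ derivBound e → Step x a ξ → ξ ∈ derivBound e := by
  induction e with
  | zero => intro x a ξ hx; exact absurd hx (Set.notMem_empty _)
  | act b => intro x a ξ hx; cases hx
  | sum e f he hf =>
    intro x a ξ hx hs
    rcases hx with hx | hx
    · exact Or.inl (he x a ξ hx hs)
    · exact Or.inr (hf x a ξ hx hs)
  | prod e f he hf =>
    intro x a ξ hx hs
    rcases hx with (⟨y, hy, hyx⟩ | hx) | hx
    · cases y with
      | none => cases hyx
      | some y =>
        cases hyx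
        cases hs with
        | prod_exp h => exact Or.inl (Or.inl ⟨_, he _ _ _ hy h, rfl⟩)
        | prod_tick h => exact Or.inl (Or.inr rfl)
    · cases hx
      exact Or.inr (step_mem_derivBound hs)
    · exact Or.inr (hf x a ξ hx hs)
  | star e f he hf =>
    intro x a ξ hx hs
    rcases hx with (⟨y, hy, hyx⟩ | hx) | hx
    · cases y with
      | none => cases hyx
      | some y =>
        cases hyx
        cases hs with
        | prod_exp h => exact Or.inl (Or.inl ⟨_, he _ _ _ hy h, rfl⟩)
        | prod_tick h => exact Or.inl (Or.inr rfl)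
    · cases hx
      exact step_mem_derivBound hs
    · exact Or.inr (hf x a ξ hx hs)

theorem iteratedDerivatives_finite (e : StarExp A) : (iteratedDerivatives e).Finite := by
  refine ((derivBound_finite e).insert (some e)).subset fun p hp => ?_
  induction hp with
  | refl => exact Or.inl rfl
  | tail _ h ih =>
    obtain ⟨a, x, rfl, hs⟩ := h
    rcases ih with ih | ih
    · cases ih
      exact Or.inr (step_mem_derivBound hs)
    · exact Or.inr (derivBound_closed e x a _ ih hs)

theorem reachable_in_chart (e : StarExp A) {p : Option (StarExp A)}
    (hp : p ∈ iteratedDerivatives e) :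
    Relation.ReflTransGen
      (fun p q => ∃ a, p ∈ iteratedDerivatives e ∧ Trans p a q) (some e) p := by
  induction hp with
  | refl => exact Relation.ReflTransGen.refl
  | tail h₁ h₂ ih =>
    obtain ⟨a, ha⟩ := h₂
    exact ih.tail ⟨a, h₁, ha⟩

/-- The chart interpretation of the star expression `e`: its start vertex is `e`, its vertices are
the iterated derivatives of `e`, and its transitions are those between these vertices. -/
def chart (e : StarExp A) : Chart A (StarExp A) where
  verts := iteratedDerivatives e
  finite_verts := iteratedDerivatives_finite e
  start := e
  start_mem := Relation.ReflTransGen.refl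
  trans p a q := p ∈ iteratedDerivatives e ∧ Trans p a q
  source_mem _ _ _ h := h.1
  target_mem _ a _ h := Relation.ReflTransGen.tail h.1 ⟨a, h.2⟩
  tick_sink := by
    rintro a q ⟨_, x, hx, _⟩
    cases hx
  connected _ hp := reachable_in_chart e hp

/-- Derivability in the proof system BBP: `BBP e f` says that the equation `e = f` between star
expressions is derivable from all instances of the axioms (B1)-(B7), (BKS1), (BKS2) by the rules
of equational logic and the fixed-point rule (RSP⊛). -/
inductive BBP : StarExp A → StarExp A → Prop
  | refl (x : StarExp A) : BBP x x
  | symm {x y : StarExp A} : BBP x y → BBP y x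
  | trans {x y z : StarExp A} : BBP x y → BBP y z → BBP x z
  | sum_congr {x x' y y' : StarExp A} : BBP x x' → BBP y y' → BBP (sum x y) (sum x' y')
  | prod_congr {x x' y y' : StarExp A} : BBP x x' → BBP y y' → BBP (prod x y) (prod x' y')
  | star_congr {x x' y y' : StarExp A} : BBP x x' → BBP y y' → BBP (star x y) (star x' y')
  | B1 (x y : StarExp A) : BBP (sum x y) (sum y x)
  | B2 (x y z : StarExp A) : BBP (sum (sum x y) z) (sum x (sum y z))
  | B3 (x : StarExp A) : BBP (sum x x) x
  | B4 (x y z : StarExp A) : BBP (prod (sum x y) z) (sum (prod x z) (prod y z))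
  | B5 (x y z : StarExp A) : BBP (prod (prod x y) z) (prod x (prod y z))
  | B6 (x : StarExp A) : BBP (sum x zero) x
  | B7 (x : StarExp A) : BBP (prod zero x) zero
  | BKS1 (x y : StarExp A) : BBP (sum (prod x (star x y)) y) (star x y)
  | BKS2 (x y z : StarExp A) : BBP (prod (star x y) z) (star x (prod y z))
  | RSP {x y z : StarExp A} : BBP x (sum (prod y x) z) → BBP x (star y z)

end StarExp

/-! Both expressions solve one and the same recursive specification, whose unknowns are the
bisimilarity classes of their derivatives. If that specification has a provable solution `s`, then
pulling `s` back along `cls` solves the specification of each expression separately. Solutions there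
are unique (`lsum_steps`, where RSP is used at each star), so each expression is provably equal to
the value of `s` at its class, and bisimilar expressions have the same class.

Solvability is the crux, since not every finite chart has a solution by star expressions. The
criterion is loop elimination in the form: every set of transitions containing no loop entry is
well-founded. Expressions satisfy it (`acc_derivBound`). It descends to the bisimilarity quotient
(`acc_cls_of_stuck`): a set without loop entries below pulls back to one above, because loops
project, and well-foundedness above projects back down. It also suffices for solvability
(`exists_solution`): loops are removed one vertex at a time and stored as the body of a star there,
until a well-founded system remains. -/

namespace StarExp

variable {A : Type u} {V : Type v}

/-! ### Derivable equations between finite sums -/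

/-- Sequential composition with a continuation, where `none` stands for termination. -/
def app (e : StarExp A) : Option (StarExp A) → StarExp A
  | none => e
  | some g => prod e g

/-- The sum of the summands `a · h ξ` for the entries `(a, ξ)` of a list. -/
def lsum (h : Option V → Option (StarExp A)) : List (A × Option V) → StarExp A
  | [] => zero
  | p :: l => sum (app (act p.1) (h p.2)) (lsum h l)

namespace BBP

theorem zero_sum (x : StarExp A) : BBP (sum zero x) x := (B1 _ _).trans (B6 _)

theorem zero_star (x : StarExp A) : BBP (star zero x) x :=
  (BKS1 _ _).symm.trans ((sum_congr (B7 _) (refl _)).trans (zero_sum x))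

theorem sum_left_comm (x y z : StarExp A) : BBP (sum x (sum y z)) (sum y (sum x z)) :=
  (B2 _ _ _).symm.trans ((sum_congr (B1 _ _) (refl _)).trans (B2 _ _ _))

theorem app_zero : ∀ k : Option (StarExp A), BBP (app zero k) zero
  | none => refl _
  | some _ => B7 _

theorem app_sum (x y : StarExp A) : ∀ k, BBP (app (sum x y) k) (sum (app x k) (app y k))
  | none => refl _
  | some _ => B4 _ _ _

theorem app_prod (x y : StarExp A) : ∀ k, BBP (app (prod x y) k) (prod x (app y k))
  | none => refl _
  | some _ => B5 _ _ _

theorem app_star (x y : StarExp A) : ∀ k, BBP (app (star x y) k) (star x (app y k))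
  | none => refl _
  | some _ => BKS2 _ _ _

theorem lsum_append (h : Option V → Option (StarExp A)) (l m : List (A × Option V)) :
    BBP (lsum h (l ++ m)) (sum (lsum h l) (lsum h m)) := by
  induction l with
  | nil => exact (zero_sum _).symm
  | cons p l ih => exact (sum_congr (refl _) ih).trans (B2 _ _ _).symm

theorem lsum_absorb (h : Option V → Option (StarExp A)) {p : A × Option V}
    {l : List (A × Option V)} (hp : p ∈ l) :
    BBP (sum (app (act p.1) (h p.2)) (lsum h l)) (lsum h l) := by
  induction l with
  | nil => cases hp
  | cons q l ih =>
    rcases List.mem_cons.1 hp with rfl | hp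
    · exact (B2 _ _ _).symm.trans (sum_congr (B3 _) (refl _))
    · exact (sum_left_comm _ _ _).trans (sum_congr (refl _) (ih hp))

theorem lsum_absorb_subset (h : Option V → Option (StarExp A)) {l m : List (A × Option V)}
    (hlm : ∀ p ∈ l, p ∈ m) : BBP (sum (lsum h l) (lsum h m)) (lsum h m) := by
  induction l with
  | nil => exact zero_sum _
  | cons p l ih =>
    exact (B2 _ _ _).trans ((sum_congr (refl _) (ih fun q hq => hlm q (.tail _ hq))).trans
      (lsum_absorb h (hlm p (.head _))))

/-- Each sum absorbs the other, by (B1)–(B3), so order and multiplicity of summands are irrelevant.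
-/
theorem lsum_eq_of_mem_iff (h : Option V → Option (StarExp A)) {l m : List (A × Option V)}
    (hlm : ∀ p, p ∈ l ↔ p ∈ m) : BBP (lsum h l) (lsum h m) :=
  (lsum_absorb_subset h fun p hp => (hlm p).2 hp).symm.trans
    ((B1 _ _).trans (lsum_absorb_subset h fun p hp => (hlm p).1 hp))

theorem lsum_filter (h : Option V → Option (StarExp A)) (c : A × Option V → Bool)
    (l : List (A × Option V)) :
    BBP (sum (lsum h (l.filter c)) (lsum h (l.filter fun p => !c p))) (lsum h l) := by
  refine (lsum_append _ _ _).symm.trans (lsum_eq_of_mem_iff h fun p => ?_)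
  cases hc : c p <;> simp [hc]

end BBP

theorem lsum_congr {h h' : Option V → Option (StarExp A)} {l : List (A × Option V)}
    (hl : ∀ p ∈ l, h p.2 = h' p.2) : lsum h l = lsum h' l := by
  induction l with
  | nil => rfl
  | cons p l ih =>
    simp only [lsum]
    rw [hl p (.head _), ih fun q hq => hl q (.tail _ hq)]

theorem lsum_map {W : Type w} (h : Option W → Option (StarExp A)) (f : Option V → Option W)
    (l : List (A × Option V)) :
    lsum h (l.map fun p => (p.1, f p.2)) = lsum (fun ξ => h (f ξ)) l := by
  induction l with
  | nil => rfl
  | cons p l ih => simp only [List.map_cons, lsum, ih]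

/-! ### The transitions of a star expression as a list -/

/-- The target in `e · f` (or, for `f = e ⊛ g`, in `e ⊛ g`) of a transition of `e` to `ξ`. -/
def cont (f : StarExp A) : Option (StarExp A) → Option (StarExp A)
  | none => some f
  | some x => some (prod x f)

/-- The list of all transitions from a star expression. -/
def steps : StarExp A → List (A × Option (StarExp A))
  | zero => []
  | act a => [(a, none)]
  | sum e f => steps e ++ steps f
  | prod e f => (steps e).map fun p => (p.1, cont f p.2)
  | star e f => ((steps e).map fun p => (p.1, cont (star e f) p.2)) ++ steps f

theorem step_prod_iff {e f : StarExp A} {a : A} {ξ : Option (StarExp A)} :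
    Step (prod e f) a ξ ↔ ∃ η, Step e a η ∧ cont f η = ξ := by
  constructor
  · intro h
    cases h with
    | prod_exp h => exact ⟨_, h, rfl⟩
    | prod_tick h => exact ⟨_, h, rfl⟩
  · rintro ⟨_ | x, h, rfl⟩
    · exact .prod_tick h
    · exact .prod_exp h

theorem step_star_iff {e f : StarExp A} {a : A} {ξ : Option (StarExp A)} :
    Step (star e f) a ξ ↔ (∃ η, Step e a η ∧ cont (star e f) η = ξ) ∨ Step f a ξ := by
  constructor
  · intro h
    cases h with
    | star_exp h => exact .inl ⟨_, h, rfl⟩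
    | star_tick h => exact .inl ⟨_, h, rfl⟩
    | star_exit h => exact .inr h
  · rintro (⟨_ | x, h, rfl⟩ | h)
    · exact .star_tick h
    · exact .star_exp h
    · exact .star_exit h

theorem mem_steps {e : StarExp A} {a : A} {ξ : Option (StarExp A)} :
    (a, ξ) ∈ steps e ↔ Step e a ξ := by
  induction e generalizing ξ with
  | zero =>
    constructor
    · intro h
      cases h
    · intro h
      cases h
  | act b =>
    constructor
    · intro h
      obtain ⟨rfl, rfl⟩ := Prod.mk.inj (List.mem_singleton.1 h)
      exact .act _
    · intro h
      cases h
      exact List.mem_singleton.2 rfl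
  | sum e f he hf =>
    rw [steps, List.mem_append, he, hf]
    constructor
    · rintro (h | h)
      · exact .sum_left h
      · exact .sum_right h
    · intro h
      cases h with
      | sum_left h => exact .inl h
      | sum_right h => exact .inr h
  | prod e f he hf =>
    rw [step_prod_iff]
    simp [steps, he]
  | star e f he hf =>
    rw [step_star_iff]
    simp [steps, he, hf]

/-! ### Uniqueness of solutions on star expressions -/

/-- If `h` solves the recursive specification given by the transitions of the derivatives of `e`,
with continuation `h none` after termination, then its value at `e` is provably `e` followed by
the continuation. -/
theorem lsum_steps (e : StarExp A) :
    ∀ h : Option (StarExp A) → Option (StarExp A),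
      (∀ x, some x ∈ derivBound e → ∃ y, h (some x) = some y ∧ BBP y (lsum h (steps x))) →
      BBP (lsum h (steps e)) (app e (h none)) := by
  induction e with
  | zero => exact fun h _ => (BBP.app_zero _).symm
  | act a => exact fun h _ => .B6 _
  | sum e f he hf =>
    intro h hh
    exact (BBP.lsum_append _ _ _).trans
      ((BBP.sum_congr (he h fun x hx => hh x (.inl hx)) (hf h fun x hx => hh x (.inr hx))).trans
        (BBP.app_sum _ _ _).symm)
  | prod e f he hf =>
    intro h hh
    obtain ⟨y, hy, hyf⟩ := hh f (.inl (.inr rfl))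
    -- Termination of `e` means continuing at `f`, so the shifted solution has as its continuation
    -- the value `y` of `h` at `f`.
    have hE := he (fun ξ => h (cont f ξ)) fun x hx => by
      obtain ⟨z, hz, hzx⟩ := hh (prod x f) (.inl (.inl ⟨_, hx, rfl⟩))
      rw [steps, lsum_map] at hzx
      exact ⟨z, hz, hzx⟩
    have hF := hyf.trans (hf h fun x hx => hh x (.inr hx))
    simp only [cont, hy] at hE
    rw [steps, lsum_map]
    exact hE.trans ((BBP.prod_congr (.refl _) hF).trans (BBP.app_prod _ _ _).symm)
  | star e f he hf =>
    intro h hh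
    obtain ⟨y, hy, hys⟩ := hh (star e f) (.inl (.inr rfl))
    have hE := he (fun ξ => h (cont (star e f) ξ)) fun x hx => by
      obtain ⟨z, hz, hzx⟩ := hh (prod x (star e f)) (.inl (.inl ⟨_, hx, rfl⟩))
      rw [steps, lsum_map] at hzx
      exact ⟨z, hz, hzx⟩
    have hF := hf h fun x hx => hh x (.inr hx)
    simp only [cont, hy] at hE
    have hsum : BBP (lsum h (steps (star e f))) (sum (prod e y) (app f (h none))) := by
      refine (BBP.lsum_append _ _ _).trans (BBP.sum_congr ?_ hF)
      rw [lsum_map]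
      exact hE
    -- By `hsum`, `y` satisfies `y = e · y + app f (h none)`, so RSP determines it.
    exact hys.symm.trans ((BBP.RSP (hys.trans hsum)).trans (BBP.app_star _ _ _).symm)

/-! ### Loops -/

/-- Every path along `S` from the vertex returns to `x` unless it ends in a deadlock;
in particular it cannot lead to termination before it has reached `x`. -/
inductive LoopTo (S : Option V → Option V → Prop) (x : Option V) : Option V → Prop
  | here : LoopTo S x x
  | step (v : V) : (∀ ξ, S (some v) ξ → LoopTo S x ξ) → LoopTo S x (some v)

/-- No transition in `S` is the entry of a loop in `S`. -/
def Stuck (S : Option V → Option V → Prop) : Prop :=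
  ∀ p q, S p q → ¬ LoopTo S p q

/-- The part of `S` that lies over transitions of star expressions along `h`. -/
def pull (h : Option (StarExp A) → Option V) (S : Option V → Option V → Prop)
    (p q : Option (StarExp A)) : Prop :=
  (∃ a, Trans p a q) ∧ S (h p) (h q)

/-- A loop upstairs projects to a loop downstairs: by `hlift` every path in `S` from an image lifts,
and the lifted path must return. -/
theorem Stuck.pull {h : Option (StarExp A) → Option V} {S : Option V → Option V → Prop}
    (hS : Stuck S) (hsome : ∀ x, ∃ v, h (some x) = some v)
    (hlift : ∀ x q, S (h (some x)) q → ∃ ξ a, Step x a ξ ∧ h ξ = q) :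
    Stuck (pull h S) := by
  intro p q hpq hloop
  refine hS _ _ hpq.2 ?_
  clear hpq
  induction hloop with
  | here => exact .here
  | step x _ ih =>
    obtain ⟨v, hv⟩ := hsome x
    rw [hv]
    refine .step v fun q hq => ?_
    rw [← hv] at hq
    obtain ⟨ξ, a, hs, rfl⟩ := hlift x q hq
    exact ih ξ ⟨⟨a, x, rfl, hs⟩, hq⟩

theorem cont_lift {S : Option (StarExp A) → Option (StarExp A) → Prop}
    (hsub : ∀ p q, S p q → ∃ a, Trans p a q) (f x : StarExp A) (q : Option (StarExp A))
    (hq : S (cont f (some x)) q) : ∃ ξ a, Step x a ξ ∧ cont f ξ = q := by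
  obtain ⟨a, _, h, hs⟩ := hsub _ _ hq
  cases h
  obtain ⟨ξ, hξ, rfl⟩ := step_prod_iff.1 hs
  exact ⟨ξ, a, hξ, rfl⟩

/-- Paths through `x · f` follow derivatives of the first factor until it terminates, and then start
at `f`. -/
theorem acc_cont {S : Option (StarExp A) → Option (StarExp A) → Prop}
    (hsub : ∀ p q, S p q → ∃ a, Trans p a q) {f : StarExp A}
    (hf : Acc (fun q p => S p q) (some f)) {p : Option (StarExp A)}
    (hp : Acc (fun q p => pull (cont f) S p q) p) :
    Acc (fun q p => S p q) (cont f p) := by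
  induction hp with
  | intro p _ ih =>
    cases p with
    | none => exact hf
    | some x =>
      refine .intro _ fun q hq => ?_
      obtain ⟨ξ, a, hs, rfl⟩ := cont_lift hsub f x q hq
      exact ih ξ ⟨⟨a, x, rfl, hs⟩, hq⟩

/-- If the first factor admits no infinite path, a path from `x · f` either deadlocks or reaches
`f`; it cannot terminate beforehand. -/
theorem loopTo_cont {S : Option (StarExp A) → Option (StarExp A) → Prop}
    (hsub : ∀ p q, S p q → ∃ a, Trans p a q) {f : StarExp A} {p : Option (StarExp A)}
    (hp : Acc (fun q p => pull (cont f) S p q) p) : LoopTo S (some f) (cont f p) := by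
  induction hp with
  | intro p _ ih =>
    cases p with
    | none => exact .here
    | some x =>
      refine .step _ fun q hq => ?_
      obtain ⟨ξ, a, hs, rfl⟩ := cont_lift hsub f x q hq
      exact ih ξ ⟨⟨a, x, rfl, hs⟩, hq⟩

/-- Star expressions have the loop elimination property: a set of transitions without loop entries
admits no infinite path through derivatives. -/
theorem acc_derivBound (e : StarExp A) :
    ∀ S : Option (StarExp A) → Option (StarExp A) → Prop,
      (∀ p q, S p q → ∃ a, Trans p a q) → Stuck S →
      ∀ p ∈ derivBound e, Acc (fun q p => S p q) p := by
  induction e with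
  | zero => exact fun S _ _ p hp => absurd hp (Set.notMem_empty _)
  | act a =>
    intro S hsub _ p hp
    refine .intro _ fun q hq => ?_
    obtain ⟨_, _, hx, _⟩ := hsub _ _ hq
    cases hp.symm.trans hx
  | sum e f he hf =>
    intro S hsub hS p hp
    exact hp.elim (he S hsub hS p) (hf S hsub hS p)
  | prod e f he hf =>
    intro S hsub hS
    have hF := hf S hsub hS
    have hf' : Acc (fun q p => S p q) (some f) := .intro _ fun q hq => by
      obtain ⟨_, _, hx, hs⟩ := hsub _ _ hq
      cases hx
      exact hF _ (step_mem_derivBound hs)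
    have hE := he (pull (cont f) S) (fun _ _ h => h.1)
      (hS.pull (fun x => ⟨_, rfl⟩) (cont_lift hsub f))
    rintro p ((⟨y, hy, rfl⟩ | rfl) | hp)
    · cases y with
      | none =>
        refine .intro _ fun q hq => ?_
        obtain ⟨_, _, hx, _⟩ := hsub _ _ hq
        cases hx
      | some x => exact acc_cont hsub hf' (hE _ hy)
    · exact hf'
    · exact hF p hp
  | star e f he hf =>
    intro S hsub hS
    have hF := hf S hsub hS
    have hE := he (pull (cont (star e f)) S) (fun _ _ h => h.1)
      (hS.pull (fun x => ⟨_, rfl⟩) (cont_lift hsub _))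
    have hstar : Acc (fun q p => S p q) (some (star e f)) := .intro _ fun q hq => by
      obtain ⟨_, _, hx, hs⟩ := hsub _ _ hq
      cases hx
      rcases step_star_iff.1 hs with ⟨ξ, hξ, rfl⟩ | hs
      -- An edge of `S` into the body would be a loop entry at the star, since paths in the body are
      -- finite. Hence `S` leaves the star only through `f`.
      · exact absurd (loopTo_cont hsub (hE ξ (step_mem_derivBound hξ))) (hS _ _ hq)
      · exact hF _ (step_mem_derivBound hs)
    rintro p ((⟨y, hy, rfl⟩ | rfl) | hp)
    · cases y with
      | none =>
        refine .intro _ fun q hq => ?_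
        obtain ⟨_, _, hx, _⟩ := hsub _ _ hq
        cases hx
      | some x => exact acc_cont hsub hstar (hE _ hy)
    · exact hstar
    · exact hF p hp

theorem acc_of_stuck {S : Option (StarExp A) → Option (StarExp A) → Prop}
    (hsub : ∀ p q, S p q → ∃ a, Trans p a q) (hS : Stuck S) (p : Option (StarExp A)) :
    Acc (fun q p => S p q) p :=
  .intro _ fun q hq => by
    obtain ⟨_, x, _, hs⟩ := hsub _ _ hq
    exact acc_derivBound x S hsub hS q (step_mem_derivBound hs)

/-! ### Existence of solutions -/

/-- The edges of the transition system with transition lists `T`. -/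
def Edge (T : V → List (A × Option V)) (p q : Option V) : Prop :=
  ∃ v a, p = some v ∧ (a, q) ∈ T v

/-- The equation at the vertex `v` of the recursive specification with loop parts `L` and
transition lists `T`. -/
def SolvesAt (L : V → StarExp A) (T : V → List (A × Option V)) (s : V → StarExp A) (v : V) : Prop :=
  BBP (s v) (star (L v) (lsum (Option.map s) (T v)))

/-- The value of `s` at the vertex `ξ ≠ √` is provably `k` followed by `y`, where `k = none` stands
for the empty expression. -/
def FactorsAs (s : V → StarExp A) (y : StarExp A) (ξ : Option V) (k : Option (StarExp A)) : Prop :=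
  ∃ v, ξ = some v ∧ BBP (s v) (k.elim y fun p => prod p y)

/-- Common right factors are pulled out by (B4), (B5) and (B7); an empty factor `none` leaves the
bare action in front of `y`. -/
theorem lsum_factor {s : V → StarExp A} {y : StarExp A} {k : Option V → Option (StarExp A)}
    {l : List (A × Option V)} (hl : ∀ p ∈ l, FactorsAs s y p.2 (k p.2)) :
    BBP (lsum (Option.map s) l) (prod (lsum k l) y) := by
  induction l with
  | nil => exact (BBP.B7 _).symm
  | cons p l ih =>
    refine (BBP.sum_congr ?_ (ih fun q hq => hl q (.tail _ hq))).trans (BBP.B4 _ _ _).symm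
    obtain ⟨v, hv, hvk⟩ := hl p (.head _)
    rw [hv] at hvk ⊢
    refine (BBP.prod_congr (.refl _) hvk).trans ?_
    cases k (some v) with
    | none => exact .refl _
    | some z => exact (BBP.B5 _ _ _).symm

/-- The body of a loop at `x` can be solved uniformly in terms of the value at `x`. -/
theorem LoopTo.exists_factor {L : V → StarExp A} {T : V → List (A × Option V)} {x : V}
    {ξ : Option V} (h : LoopTo (Edge T) (some x) ξ) :
    ∃ k, ∀ s, (∀ v, v ≠ x → SolvesAt L T s v) → FactorsAs s (s x) ξ k := by
  induction h with
  | here => exact ⟨none, fun s _ => ⟨x, rfl, .refl _⟩⟩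
  | step v _ ih =>
    -- The equation at `x` itself is not available, so a path meeting `x` stops there with the empty
    -- factor.
    by_cases hv : v = x
    · exact ⟨none, fun s _ => ⟨v, rfl, hv ▸ .refl _⟩⟩
    · choose! k hk using ih
      refine ⟨some (star (L v) (lsum k (T v))), fun s hs => ⟨v, rfl, (hs v hv).trans ?_⟩⟩
      refine (BBP.star_congr (.refl _) (lsum_factor fun p hp => ?_)).trans (BBP.BKS2 _ _ _).symm
      exact hk p.2 ⟨v, p.1, rfl, hp⟩ s hs

theorem exists_solution_of_wellFounded (L : V → StarExp A) (T : V → List (A × Option V))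
    (hwf : ∀ p, Acc (fun q p => Edge T p q) p) : ∃ s, ∀ v, SolvesAt L T s v := by
  classical
  have hwf' : WellFounded fun u v : V => Edge T (some v) (some u) :=
    InvImage.wf some ⟨hwf⟩
  -- Well-founded recursion along edges. The default `none` never matters, because every non-`√`
  -- target listed in `T v` is an edge.
  let G : (v : V) → ((u : V) → Edge T (some v) (some u) → StarExp A) → StarExp A :=
    fun v r => star (L v) (lsum (fun ξ => ξ.bind fun u =>
      if h : Edge T (some v) (some u) then some (r u h) else none) (T v))
  refine ⟨hwf'.fix G, fun v => ?_⟩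
  have hfix := hwf'.fix_eq G v
  unfold SolvesAt
  rw [hfix]
  have : lsum (fun ξ => ξ.bind fun u =>
      if h : Edge T (some v) (some u) then some (hwf'.fix G u) else none) (T v) =
      lsum (Option.map (hwf'.fix G)) (T v) := by
    refine lsum_congr fun p hp => ?_
    obtain ⟨a, _ | u⟩ := p
    · rfl
    · have : Edge T (some v) (some u) := ⟨v, a, rfl, hp⟩
      simp [this]
  simp only [G, this]
  exact .refl _

/-- A finite transition system with the loop elimination property has a solution. -/
theorem exists_solution (F : Finset V) (L : V → StarExp A) (T : V → List (A × Option V))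
    (hF : ∀ v, v ∉ F → T v = [])
    (hloop : ∀ S : Option V → Option V → Prop, (∀ p q, S p q → Edge T p q) → Stuck S →
      ∀ p, Acc (fun q p => S p q) p) :
    ∃ s, ∀ v, SolvesAt L T s v := by
  classical
  induction hn : ∑ v ∈ F, (T v).length using Nat.strong_induction_on generalizing L T with
  | _ n ih =>
  by_cases hst : Stuck (Edge T)
  · exact exists_solution_of_wellFounded L T (hloop _ (fun _ _ h => h) hst)
  simp only [Stuck, not_forall, not_not] at hst
  obtain ⟨_, q, ⟨x, a, rfl, haq⟩, hq⟩ := hst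
  -- The factors must not depend on `s`: they enter the new loop part `L'`, which is fixed before
  -- `s` is found.
  have hk : ∀ ξ, LoopTo (Edge T) (some x) ξ → ∃ k, ∀ s, (∀ v, v ≠ x → SolvesAt L T s v) →
      FactorsAs s (s x) ξ k := fun ξ hξ => hξ.exists_factor
  choose! k hk using hk
  -- All loop entries at `x` are removed together and become summands of the star body at `x`.
  let c : A × Option V → Bool := fun p => decide (LoopTo (Edge T) (some x) p.2)
  let T' := Function.update T x ((T x).filter fun p => !c p)
  let L' := Function.update L x (sum (L x) (lsum k ((T x).filter c)))
  have hT' : ∀ v, (T' v).Sublist (T v) := by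
    intro v
    by_cases hv : v = x
    · subst hv
      simp [T']
    · simp [T', hv]
  have hx : x ∈ F := by
    by_contra hx
    simp [hF x hx] at haq
  have hlt : ∑ v ∈ F, (T' v).length < ∑ v ∈ F, (T v).length := by
    refine Finset.sum_lt_sum (fun v _ => (hT' v).length_le) ⟨x, hx, ?_⟩
    simp only [T', Function.update_self]
    refine List.length_filter_lt_length_iff_exists.2 ⟨_, haq, ?_⟩
    simp [c, hq]
  obtain ⟨s, hs⟩ := ih _ (hn ▸ hlt) L' T'
    (fun v hv => List.sublist_nil.1 (hF v hv ▸ hT' v))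
    (fun S hS => hloop S fun p q h => by
      obtain ⟨v, b, hp, hb⟩ := hS p q h
      exact ⟨v, b, hp, (hT' v).subset hb⟩) rfl
  have hne : ∀ v, v ≠ x → SolvesAt L T s v := fun v hv => by
    simpa [SolvesAt, L', T', hv] using hs v
  refine ⟨s, fun v => ?_⟩
  by_cases hv : v = x
  swap
  · exact hne v hv
  subst hv
  have hsv := hs v
  simp only [SolvesAt, L', T', Function.update_self] at hsv
  have hU : BBP (lsum (Option.map s) ((T v).filter c)) (prod (lsum k ((T v).filter c)) (s v)) :=
    lsum_factor fun p hp => hk p.2 (by simpa [c] using (List.mem_filter.1 hp).2) s hne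
  refine BBP.RSP ?_
  -- With `U` the removed loop body and `R` the remaining sum, unfolding `(L + U) ⊛ R` gives `s v =
  -- L · s v + (U · s v + R)`. The bracket is the original sum, and RSP refolds with body `L` alone.
  refine hsv.trans ((BBP.BKS1 _ _).symm.trans ?_)
  refine (BBP.sum_congr (BBP.prod_congr (.refl _) hsv.symm) (.refl _)).trans ?_
  refine (BBP.sum_congr (BBP.B4 _ _ _) (.refl _)).trans ((BBP.B2 _ _ _).trans ?_)
  refine BBP.sum_congr (.refl _) ?_
  exact (BBP.sum_congr hU.symm (.refl _)).trans (BBP.lsum_filter _ _ _)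

/-! ### The quotient by bisimilarity -/

/-- `B` is a bisimulation on the transition system of all star expressions. -/
structure IsBisim (B : Option (StarExp A) → Option (StarExp A) → Prop) : Prop where
  forth : ∀ p q, B p q → ∀ a p', Trans p a p' → ∃ q', Trans q a q' ∧ B p' q'
  back : ∀ p q, B p q → ∀ a q', Trans q a q' → ∃ p', Trans p a p' ∧ B p' q'
  termination : ∀ p q, B p q → (p = none ↔ q = none)

/-- Bisimilarity of star expressions. -/
def Bisim (e f : StarExp A) : Prop := ∃ B, IsBisim B ∧ B (some e) (some f)

theorem bisim_equivalence : Equivalence (Bisim (A := A)) where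
  refl e := ⟨Eq, ⟨by rintro p _ rfl a p' h; exact ⟨p', h, rfl⟩,
    by rintro p _ rfl a p' h; exact ⟨p', h, rfl⟩, by rintro p _ rfl; rfl⟩, rfl⟩
  symm := by
    rintro e f ⟨B, hB, h⟩
    exact ⟨fun p q => B q p, ⟨fun p q => hB.back q p, fun p q => hB.forth q p,
      fun p q h => (hB.termination q p h).symm⟩, h⟩
  trans := by
    rintro e f g ⟨B, hB, h⟩ ⟨C, hC, h'⟩
    refine ⟨fun p q => ∃ r, B p r ∧ C r q, ⟨?_, ?_, ?_⟩, ⟨_, h, h'⟩⟩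
    · rintro p q ⟨r, hpr, hrq⟩ a p' ht
      obtain ⟨r', hr, hpr'⟩ := hB.forth _ _ hpr _ _ ht
      obtain ⟨q', hq, hrq'⟩ := hC.forth _ _ hrq _ _ hr
      exact ⟨q', hq, r', hpr', hrq'⟩
    · rintro p q ⟨r, hpr, hrq⟩ a q' ht
      obtain ⟨r', hr, hrq'⟩ := hC.back _ _ hrq _ _ ht
      obtain ⟨p', hp, hpr'⟩ := hB.back _ _ hpr _ _ hr
      exact ⟨p', hp, r', hpr', hrq'⟩
    · rintro p q ⟨r, hpr, hrq⟩
      exact (hB.termination _ _ hpr).trans (hC.termination _ _ hrq)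

/-- The setoid of bisimilarity. -/
def bisimSetoid (A : Type u) : Setoid (StarExp A) := ⟨Bisim, bisim_equivalence⟩

/-- The bisimilarity class of a star expression. -/
def cls (e : StarExp A) : Quotient (bisimSetoid A) := Quotient.mk _ e

theorem cls_eq_iff {e f : StarExp A} : cls e = cls f ↔ Bisim e f := Quotient.eq (r := bisimSetoid A)

theorem Bisim.step {e f : StarExp A} (h : Bisim e f) {a : A} {ξ : Option (StarExp A)}
    (hs : Step e a ξ) : ∃ η, Step f a η ∧ η.map cls = ξ.map cls := by
  obtain ⟨B, hB, hef⟩ := h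
  obtain ⟨η, ⟨_, hx, hη⟩, hξη⟩ := hB.forth _ _ hef a ξ ⟨e, rfl, hs⟩
  cases hx
  refine ⟨η, hη, ?_⟩
  have ht := hB.termination _ _ hξη
  cases ξ with
  | none => rw [ht.1 rfl]
  | some x =>
    cases η with
    | none => cases ht.2 rfl
    | some y => exact congrArg some (cls_eq_iff.2 ⟨B, hB, hξη⟩).symm

theorem bisim_of_chart_bisimilar {e f : StarExp A} (h : Chart.Bisimilar (chart e) (chart f)) :
    Bisim e f := by
  obtain ⟨B, hB⟩ := h
  refine ⟨B, ⟨fun p q hpq a p' ht => ?_, fun p q hpq a q' ht => ?_, hB.termination⟩, hB.start⟩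
  · obtain ⟨q', hq, hB'⟩ := hB.forth p q hpq a p' ⟨(hB.mem_verts p q hpq).1, ht⟩
    exact ⟨q', hq.2, hB'⟩
  · obtain ⟨p', hp, hB'⟩ := hB.back p q hpq a q' ⟨(hB.mem_verts p q hpq).2, ht⟩
    exact ⟨p', hp.2, hB'⟩

open Classical in
/-- The transitions from bisimilarity classes, restricted to the classes in `F`. -/
noncomputable def clsSteps (F : Finset (Quotient (bisimSetoid A))) (q : Quotient (bisimSetoid A)) :
    List (A × Option (Quotient (bisimSetoid A))) :=
  if q ∈ F then (steps q.out).map fun p => (p.1, p.2.map cls) else []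

/-- The transitions of a class do not depend on the representative, since bisimilar expressions
match each other's steps up to `cls`. -/
theorem mem_clsSteps {F : Finset (Quotient (bisimSetoid A))} {x : StarExp A} {a : A}
    {ζ : Option (Quotient (bisimSetoid A))} :
    (a, ζ) ∈ clsSteps F (cls x) ↔ cls x ∈ F ∧ ∃ ξ, Step x a ξ ∧ ξ.map cls = ζ := by
  have hout : Bisim (cls x).out x := cls_eq_iff.1 (Quotient.out_eq _)
  unfold clsSteps
  split_ifs with hx
  · simp only [List.mem_map, Prod.mk.injEq, hx, true_and]
    constructor
    · rintro ⟨⟨b, ξ⟩, hξ, rfl, rfl⟩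
      exact hout.step (mem_steps.1 hξ)
    · rintro ⟨ξ, hξ, rfl⟩
      obtain ⟨η, hη, h⟩ := (bisim_equivalence.symm hout).step hξ
      exact ⟨(a, η), mem_steps.2 hη, rfl, h⟩
  · simp [hx]

theorem acc_cls_of_stuck (F : Finset (Quotient (bisimSetoid A)))
    (S : Option (Quotient (bisimSetoid A)) → Option (Quotient (bisimSetoid A)) → Prop)
    (hsub : ∀ p q, S p q → Edge (clsSteps F) p q) (hS : Stuck S)
    (p : Option (Quotient (bisimSetoid A))) : Acc (fun q p => S p q) p := by
  have hlift : ∀ (x : StarExp A) q, S (Option.map cls (some x)) q →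
      ∃ ξ a, Step x a ξ ∧ Option.map cls ξ = q := by
    intro x q hq
    obtain ⟨_, a, hv, ha⟩ := hsub _ _ hq
    cases hv
    obtain ⟨ξ, hs, h⟩ := (mem_clsSteps.1 ha).2
    exact ⟨ξ, a, hs, h⟩
  have hacc := acc_of_stuck (S := pull (Option.map cls) S) (fun _ _ h => h.1)
    (hS.pull (fun x => ⟨_, rfl⟩) hlift)
  have key : ∀ r : Option (StarExp A), Acc (fun q p => S p q) (r.map cls) := by
    intro r
    induction hacc r with
    | intro r _ ih =>
      refine .intro _ fun q hq => ?_
      cases r with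
      | none =>
        obtain ⟨_, _, hv, _⟩ := hsub _ _ hq
        cases hv
      | some x =>
        obtain ⟨ξ, a, hs, rfl⟩ := hlift x q hq
        exact ih ξ ⟨⟨a, x, rfl, hs⟩, hq⟩
  cases p with
  | none => exact key none
  | some q =>
    obtain ⟨x, rfl⟩ := Quotient.exists_rep q
    exact key (some x)

/-- The bisimilarity classes of `e` and `f` and their derivatives have a provable solution. -/
theorem exists_invariant_solution (e f : StarExp A) :
    ∃ s : Quotient (bisimSetoid A) → StarExp A,
      ∀ x, some x ∈ insert (some e) (derivBound e) ∪ insert (some f) (derivBound f) →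
        BBP (s (cls x)) (lsum (fun ξ => ξ.map fun y => s (cls y)) (steps x)) := by
  classical
  have hD : (insert (some e) (derivBound e) ∪ insert (some f) (derivBound f)).Finite :=
    ((derivBound_finite e).insert _).union ((derivBound_finite f).insert _)
  have hfin := (hD.preimage (Option.some_injective (StarExp A)).injOn).image cls
  obtain ⟨s, hs⟩ := exists_solution hfin.toFinset (fun _ => zero) (clsSteps hfin.toFinset)
    (fun v hv => if_neg hv) (acc_cls_of_stuck _)
  -- The loop parts were started at `zero`, so the star in the solved equation vanishes.
  refine ⟨s, fun x hx => (hs (cls x)).trans ((BBP.zero_star _).trans ?_)⟩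
  have hxF : cls x ∈ hfin.toFinset := hfin.mem_toFinset.2 ⟨x, hx, rfl⟩
  have hmap := lsum_map (Option.map s) (Option.map cls) (steps x)
  simp only [Option.map_map] at hmap
  change BBP _ (lsum (fun ξ => ξ.map (s ∘ cls)) (steps x))
  rw [← hmap]
  refine BBP.lsum_eq_of_mem_iff _ ?_
  rintro ⟨a, ζ⟩
  rw [mem_clsSteps, and_iff_right hxF]
  simp [mem_steps]

theorem Bisim.bbp {e f : StarExp A} (h : Bisim e f) : BBP e f := by
  obtain ⟨s, hs⟩ := exists_invariant_solution e f
  have key : ∀ g, (∀ x, some x ∈ insert (some g) (derivBound g) →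
      some x ∈ insert (some e) (derivBound e) ∪ insert (some f) (derivBound f)) →
      BBP (s (cls g)) g := fun g hg =>
    (hs g (hg g (.inl rfl))).trans
      (lsum_steps g _ fun x hx => ⟨_, rfl, hs x (hg x (.inr hx))⟩)
  have he := key e fun _ => .inl
  have hf := key f fun _ => .inr
  rw [cls_eq_iff.2 h] at he
  exact he.symm.trans hf

end StarExp

theorem mainTheorem1 {A : Type*} (e₁ e₂ : StarExp A)
    (h : Chart.Bisimilar (StarExp.chart e₁) (StarExp.chart e₂)) :
    StarExp.BBP e₁ e₂ :=
  (StarExp.bisim_of_chart_bisimilar h).bbp
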